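/- Let $(X,J)$ be a compact almost-complex manifold of real dimension $2n$ (smooth, without boundary), and for a Hermitian metric on $(X,J)$ with fundamental form $\omega$ let $\mathcal H^{p,q}_{\bar\partial,\omega}$ denote the kernel on the space $A^{p,q}(X)$ of smooth complex $(p,q)$-forms of the Laplacian $\Delta_{\bar\partial}=\bar\partial\,\bar\partial^*+\bar\partial^*\bar\partial$. Here $\bar\partial$ is, on $A^{p,q}(X)$, the $(p,q+1)$-component of the exterior derivative $d$, and $\bar\partial^*$ is the formal adjoint of $\bar\partial$ with respect to the $L^2$ Hermitian product on forms defined by the metric. Put $h^{p,q}_{\bar\partial,\omega}=\dim_{\mathbb C}\mathcal H^{p,q}_{\bar\partial,\omega}$. Let $\omega$ and $\tilde\omega=\Phi\,\omega$ be the fundamental forms of two conformal Hermitian metrics on $(X,J)$, where $\Phi$ is a smooth positive function on $X$. Then for all $p,q\ge 0$ with $p+q=n$, $$\mathcal H^{p,q}_{\bar\partial,\Phi\omega}=\mathcal H^{p,q}_{\bar\partial,\omega},\qquad\text{and hence}\qquad h^{p,q}_{\bar\partial,\Phi\omega}=h^{p,q}_{\bar\partial,\omega}.$$ That is, $h^{p,q}_{\bar\partial}$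 with $p+q=n$ is a conformal invariant of Hermitian metrics. In particular, if $\dim_{\mathbb R}X=4$, then $h^{1,1}_{\bar\partial}$ is a conformal invariant. -/

import Mathlib

open scoped Manifold ContDiff Topology

noncomputable section

/-! ### Linear algebra: types of complex-valued alternating forms -/

namespace AlmostHermitian

section LinearAlgebra

variable {V : Type*} [AddCommGroup V] [Module ℝ V] [TopologicalSpace V]
  [ContinuousConstSMul ℝ V]

/-- Let `J` be a complex structure on the real vector space `V`. A real vector `v` splits in `V ⊗ ℂ`
as `v = v^{1,0} + v^{0,1}` with `v^{1,0} = (v - i J v) / 2` and `v^{0,1} = (v + i J v) / 2`.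
For a complex-valued real-multilinear form `η`, with complex multilinear extension `η_ℂ`,
`bidegreePart J S η` is `v ↦ η_ℂ (w_1, …, w_k)`, where `w_j = v_j^{1,0}` for `j ∈ S` and
`w_j = v_j^{0,1}` for `j ∉ S`. The extension is expanded over the set `T` of those slots in which
the summand `∓ i J v_j / 2` is inserted. -/
def bidegreePart (J : V →L[ℝ] V) {k : ℕ} (S : Finset (Fin k)) (η : V [⋀^Fin k]→L[ℝ] ℂ) :
    ContinuousMultilinearMap ℝ (fun _ : Fin k => V) ℂ :=
  ∑ T : Finset (Fin k), (Complex.I ^ T.card) •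
    η.toContinuousMultilinearMap.compContinuousLinearMap (fun j =>
      if j ∈ T then (if j ∈ S then (-(1 / 2) : ℝ) else (1 / 2 : ℝ)) • J
      else (1 / 2 : ℝ) • ContinuousLinearMap.id ℝ V)

/-- A complex-valued alternating form of degree `k` has type `(p, q)` if `p + q = k` and its complex
multilinear extension vanishes as soon as its arguments are vectors of type `(1,0)` or `(0,1)`
among which the number of those of type `(1,0)` is not `p`. -/
def HasType (J : V →L[ℝ] V) (p q : ℕ) {k : ℕ} (η : V [⋀^Fin k]→L[ℝ] ℂ) : Prop :=
  p + q = k ∧ ∀ S : Finset (Fin k), S.card ≠ p → bidegreePart J S η = 0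

lemma bidegreePart_map_swap (J : V →L[ℝ] V) {k : ℕ} (S : Finset (Fin k))
    (η : V [⋀^Fin k]→L[ℝ] ℂ) (v : Fin k → V) {i j : Fin k} (hv : v i = v j) (hij : i ≠ j) :
    bidegreePart J (S.map (Equiv.swap i j).toEmbedding) η v = - bidegreePart J S η v := by
  set σ := Equiv.swap i j with hσ
  have hvσ : ∀ a, v (σ a) = v a := by
    intro a
    rcases eq_or_ne a i with rfl | hai
    · simp [hσ, hv]
    · rcases eq_or_ne a j with rfl | haj
      · simp [hσ, hv]
      · simp [hσ, Equiv.swap_apply_of_ne_of_ne hai haj]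
  simp only [bidegreePart, sum_apply, smul_apply,
    ContinuousMultilinearMap.compContinuousLinearMap_apply]
  rw [← Finset.sum_neg_distrib]
  refine (Fintype.sum_equiv σ.finsetCongr _ _ (fun T => ?_)).symm
  have hmem : ∀ (A : Finset (Fin k)) (a : Fin k), a ∈ A.map σ.toEmbedding ↔ σ a ∈ A := by
    intro A a
    rw [Finset.mem_map_equiv, hσ, Equiv.symm_swap]
  have key := η.toAlternatingMap.map_swap (fun a => (if a ∈ T then
      (if a ∈ S then (-(1 / 2) : ℝ) else (1 / 2 : ℝ)) • J
      else (1 / 2 : ℝ) • ContinuousLinearMap.id ℝ V) (v a)) hij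
  simp only [Equiv.finsetCongr_apply, Finset.card_map, hmem]
  rw [← smul_neg]
  congr 1
  refine key.symm.trans ?_
  refine congrArg η.toAlternatingMap (funext fun a => ?_)
  simp only [Function.comp_apply, ← hσ, hvσ]

/-- The component of type `(p, k - p)` of a complex-valued alternating form of degree `k`. -/
def typePart (J : V →L[ℝ] V) (p : ℕ) {k : ℕ} (η : V [⋀^Fin k]→L[ℝ] ℂ) : V [⋀^Fin k]→L[ℝ] ℂ where
  toContinuousMultilinearMap := ∑ S ∈ (Finset.univ : Finset (Fin k)).powersetCard p, bidegreePart J S η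
  map_eq_zero_of_eq' := by
    intro v i j hv hij
    have h : ∑ S ∈ (Finset.univ : Finset (Fin k)).powersetCard p, bidegreePart J S η v
        = - ∑ S ∈ (Finset.univ : Finset (Fin k)).powersetCard p, bidegreePart J S η v := by
      rw [← Finset.sum_neg_distrib]
      refine (Finset.sum_equiv (Equiv.swap i j).finsetCongr ?_ ?_).symm
      · intro S
        simp [Finset.mem_powersetCard]
      · intro S _
        rw [Equiv.finsetCongr_apply, bidegreePart_map_swap J S η v hv hij]
    simpa using self_eq_neg.mp h

end LinearAlgebra

/-! ### Almost-complex manifolds, Hermitian metrics, differential forms -/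

/-- The Euclidean space on which a `2n`-dimensional manifold is modelled. -/
abbrev Model (n : ℕ) : Type := EuclideanSpace ℝ (Fin (2 * n))

variable {n : ℕ} {M : Type*} [TopologicalSpace M] [ChartedSpace (Model n) M]

variable (n M) in
/-- An almost-complex structure on a `2n`-dimensional manifold: a smooth field of endomorphisms of
the tangent spaces whose square is `-1`. -/
structure AlmostComplexStructure [IsManifold (𝓡 (2 * n)) ∞ M] where
  toFun : ∀ x : M, TangentSpace (𝓡 (2 * n)) x →L[ℝ] TangentSpace (𝓡 (2 * n)) x
  sq_eq : ∀ (x : M) (v : TangentSpace (𝓡 (2 * n)) x), toFun x (toFun x v) = -v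
  smooth : ContMDiff (𝓡 (2 * n)) ((𝓡 (2 * n)).prod 𝓘(ℝ, Model n →L[ℝ] Model n)) ∞
    (fun x => (Bundle.TotalSpace.mk' (Model n →L[ℝ] Model n) x (toFun x) :
      Bundle.TotalSpace (Model n →L[ℝ] Model n)
        (fun x : M => TangentSpace (𝓡 (2 * n)) x →L[ℝ] TangentSpace (𝓡 (2 * n)) x)))

/-- A Hermitian metric on an almost-complex manifold: a smooth Riemannian metric for which `J` is
an isometry. -/
structure HermitianMetric [IsManifold (𝓡 (2 * n)) ∞ M] (J : AlmostComplexStructure n M) extends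
    Bundle.ContMDiffRiemannianMetric (𝓡 (2 * n)) ∞ (Model n)
      (fun x : M => TangentSpace (𝓡 (2 * n)) x) where
  map_J : ∀ (x : M) (u v : TangentSpace (𝓡 (2 * n)) x),
    inner x (J.toFun x u) (J.toFun x v) = inner x u v

/-- The fundamental form `ω(u, v) = g(J u, v)` of a Hermitian metric. -/
def HermitianMetric.fundamentalForm [IsManifold (𝓡 (2 * n)) ∞ M] {J : AlmostComplexStructure n M}
    (g : HermitianMetric J) (x : M) (u v : TangentSpace (𝓡 (2 * n)) x) : ℝ :=
  g.inner x (J.toFun x u) v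

variable (n M) in
/-- Complex-valued differential forms of degree `k`, without any regularity. -/
abbrev Form (k : ℕ) : Type _ := ∀ x : M, TangentSpace (𝓡 (2 * n)) x [⋀^Fin k]→L[ℝ] ℂ

/-- The differential at `y` of the inverse of the chart at `c`; it sends the standard basis of
`Model n` to the coordinate vector fields. -/
def coordFrame (c : M) (y : Model n) :
    Model n →L[ℝ] TangentSpace (𝓡 (2 * n)) ((chartAt (Model n) c).symm y) :=
  mfderiv (𝓡 (2 * n)) (𝓡 (2 * n)) (chartAt (Model n) c).symm y

/-- The expression of a form in the chart at `c` (its pullback by the inverse of the chart). -/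
def Form.inChart {k : ℕ} (η : Form n M k) (c : M) (y : Model n) : Model n [⋀^Fin k]→L[ℝ] ℂ :=
  (η ((chartAt (Model n) c).symm y)).compContinuousLinearMap (coordFrame c y)

/-- Smoothness of a form: its expressions in the charts are smooth. -/
def Form.IsSmooth {k : ℕ} (η : Form n M k) : Prop :=
  ∀ c : M, ContDiffOn ℝ ∞ (η.inChart c) (chartAt (Model n) c).target

/-- The exterior derivative, computed at `x` in the chart at `x`. -/
def Form.d {k : ℕ} (η : Form n M k) : Form n M (k + 1) := fun x =>
  (extDeriv (η.inChart x) (chartAt (Model n) x x)).compContinuousLinearMap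
    (mfderiv (𝓡 (2 * n)) (𝓡 (2 * n)) (chartAt (Model n) x) x)

section Dbar

variable [IsManifold (𝓡 (2 * n)) ∞ M] (J : AlmostComplexStructure n M)

/-- The component of type `(p, k - p)` of a form of degree `k`. -/
def Form.part (p : ℕ) {k : ℕ} (η : Form n M k) : Form n M k := fun x => typePart (J.toFun x) p (η x)

/-- The space `A^{p,q}(X)` of smooth forms of type `(p, q)`. -/
def smoothForms (p q : ℕ) : Set (Form n M (p + q)) :=
  {η | η.IsSmooth ∧ ∀ x, HasType (J.toFun x) p q (η x)}

/-- The operator `∂̄`: on forms of type `(p, q)` it is the component of type `(p, q + 1)` of the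
exterior derivative, and it is extended additively to all forms of degree `k = p + q`. -/
def Form.dbar {k : ℕ} (η : Form n M k) : Form n M (k + 1) :=
  ∑ p ∈ Finset.range (k + 1), ((η.part J p).d).part J p

end Dbar

/-! ### The `L²` product, the adjoint of `∂̄` and the Laplacian -/

/-- The Hermitian product of two complex alternating `k`-forms on `Model n` induced by the real inner
product with matrix `G`: in components,
`(1 / k!) ∑ G^{i₁ j₁} ⋯ G^{i_k j_k} η_{i₁ … i_k} conj ζ_{j₁ … j_k}`, with `G^{i j}` the inverse
matrix; for an orthonormal basis this is the sum of `η_I conj ζ_I` over increasing `I`. -/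
def coordInner (G : Matrix (Fin (2 * n)) (Fin (2 * n)) ℝ) {k : ℕ}
    (η ζ : Model n [⋀^Fin k]→L[ℝ] ℂ) : ℂ :=
  ((k.factorial : ℂ))⁻¹ * ∑ a : Fin k → Fin (2 * n), ∑ b : Fin k → Fin (2 * n),
    ((∏ l, G⁻¹ (a l) (b l) : ℝ) : ℂ) * η (fun l => EuclideanSpace.single (a l) (1 : ℝ)) *
      (starRingEnd ℂ) (ζ (fun l => EuclideanSpace.single (b l) (1 : ℝ)))

variable (n M) in
/-- A smooth partition of unity on a compact manifold, subordinate to the domains of the charts.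
The integrals computed with it do not depend on which one is taken. -/
def chartPartition [IsManifold (𝓡 (2 * n)) ∞ M] [T2Space M] [CompactSpace M] :
    SmoothPartitionOfUnity M (𝓡 (2 * n)) M Set.univ :=
  Classical.choose
    (SmoothPartitionOfUnity.exists_isSubordinate_chartAt_source (𝓡 (2 * n)) M)

variable [IsManifold (𝓡 (2 * n)) ∞ M] [T2Space M] [CompactSpace M] {J : AlmostComplexStructure n M}

namespace HermitianMetric

/-- The matrix `g_{ij}` of the metric in the chart at `c`. -/
def gram (g : HermitianMetric J) (c : M) (y : Model n) : Matrix (Fin (2 * n)) (Fin (2 * n)) ℝ :=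
  Matrix.of fun i j => g.inner ((chartAt (Model n) c).symm y)
    (coordFrame c y (EuclideanSpace.single i (1 : ℝ)))
    (coordFrame c y (EuclideanSpace.single j (1 : ℝ)))

/-- The `L²` Hermitian product `∫_X ⟨η, ζ⟩_g dvol_g` of two forms of degree `k`, written in charts
by a partition of unity, with `dvol_g = √det(g_{ij}) dy`. -/
def l2Inner (g : HermitianMetric J) {k : ℕ} (η ζ : Form n M k) : ℂ :=
  ∑ᶠ c : M, ∫ y in (chartAt (Model n) c).target,
    ((chartPartition n M c ((chartAt (Model n) c).symm y) * √(g.gram c y).det : ℝ) : ℂ) *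
      coordInner (g.gram c y) (η.inChart c y) (ζ.inChart c y)

/-- `α = ∂̄* ψ` for a form `ψ` of degree `m`: for `m = k + 1`, the form `α` of degree `k` is smooth
and satisfies `⟨∂̄ φ, ψ⟩ = ⟨φ, α⟩` in `L²` for all smooth forms `φ` of degree `k`. Such an `α`
exists and is unique for each smooth `ψ`. -/
def IsDbarStar (g : HermitianMetric J) {k : ℕ} (ψ : Form n M (k + 1)) (α : Form n M k) : Prop :=
  α.IsSmooth ∧ ∀ φ : Form n M k, φ.IsSmooth → g.l2Inner (φ.dbar J) ψ = g.l2Inner φ α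

/-- `ζ = Δ ψ`, where `Δ = ∂̄ ∂̄* + ∂̄* ∂̄`; here `∂̄*` is zero on forms of degree zero. -/
def IsDbarLaplacian (g : HermitianMetric J) : {k : ℕ} → (ψ ζ : Form n M k) → Prop
  | 0, ψ, ζ => g.IsDbarStar (ψ.dbar J) ζ
  | _ + 1, ψ, ζ => ∃ α β, g.IsDbarStar ψ α ∧ g.IsDbarStar (ψ.dbar J) β ∧ ζ = α.dbar J + β

/-- The space of `∂̄`-harmonic `(p, q)`-forms: the kernel of `Δ` on `A^{p,q}(X)`. -/
def harmonicForms (g : HermitianMetric J) (p q : ℕ) : Set (Form n M (p + q)) :=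
  {ψ | ψ ∈ smoothForms J p q ∧ g.IsDbarLaplacian ψ 0}

/-- The dimension `h^{p,q}` of the space of `∂̄`-harmonic `(p, q)`-forms, as a cardinal (the set
`harmonicForms g p q` is a complex subspace, hence equal to its span). -/
def hodgeNumber (g : HermitianMetric J) (p q : ℕ) : Cardinal :=
  Module.rank ℂ (Submodule.span ℂ (g.harmonicForms p q))

end HermitianMetric

end AlmostHermitian

end

/-! Under `g ↦ Φ g` the pointwise Hermitian product on forms of degree `k` is multiplied by `Φ⁻ᵏ`
and the volume density by `Φⁿ`. In degree `n` the factors cancel, so the `L²` product of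
middle-degree forms is the same for both metrics (`l2Inner_eq_of_conformal`).

It remains to express harmonicity through this product alone. Pairing `Δψ = 0` with `ψ` gives
`‖∂̄ψ‖² + ‖∂̄*ψ‖² = 0`; hence `ψ` is harmonic iff `∂̄ψ = 0` and, in positive degree, `ψ` is
orthogonal to every `∂̄φ` (`isDbarLaplacian_zero_iff`, `isDbarLaplacian_succ_iff`). The first
condition involves no metric, the second only the product in the degree of `ψ`.

The rest of the work is definiteness of the `L²` product on smooth forms
(`eq_zero_of_finsum_l2Density_eq_zero`) and smoothness of `∂̄ψ`, to which it is applied; the latter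
rests on the chart independence of `d` (`Form.inChart_d`). -/

namespace AlmostHermitian

/-! ### Alternating forms on the model space in coordinates -/

section Components

variable {n k : ℕ}

/-- The standard basis of `Model n`. -/
noncomputable abbrev stdBasis (n : ℕ) : Module.Basis (Fin (2 * n)) ℝ (Model n) :=
  (EuclideanSpace.basisFun (Fin (2 * n)) ℝ).toBasis

lemma form_ext_single {η ζ : Model n [⋀^Fin k]→L[ℝ] ℂ}
    (h : ∀ a : Fin k → Fin (2 * n), η (fun l => EuclideanSpace.single (a l) (1 : ℝ)) =
      ζ (fun l => EuclideanSpace.single (a l) (1 : ℝ))) : η = ζ := by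
  apply ContinuousAlternatingMap.toContinuousMultilinearMap_injective
  apply ContinuousMultilinearMap.toMultilinearMap_injective
  refine Module.Basis.ext_multilinear (fun _ => stdBasis n) fun a => ?_
  simpa using h a

lemma form_apply_sum {α : Type*} [Fintype α] (η : Model n [⋀^Fin k]→L[ℝ] ℂ)
    (c : Fin k → α → ℝ) (w : α → Model n) :
    η (fun l => ∑ a, c l a • w a) = ∑ r : Fin k → α, (∏ l, c l (r l)) • η (fun l => w (r l)) := by
  classical
  have h := η.toMultilinearMap.map_sum (fun l a => c l a • w a)
  refine h.trans (Finset.sum_congr rfl fun r _ => ?_)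
  exact η.toMultilinearMap.map_smul_univ (fun l => c l (r l)) (fun l => w (r l))

lemma model_eq_sum (v : Model n) :
    v = ∑ a, v a • (EuclideanSpace.single a (1 : ℝ) : Model n) := by
  conv_lhs => rw [← (stdBasis n).sum_repr v]
  simp

lemma form_apply_eq_sum (η : Model n [⋀^Fin k]→L[ℝ] ℂ) (v : Fin k → Model n) :
    η v = ∑ r : Fin k → Fin (2 * n), (∏ l, v l (r l)) •
      η (fun l => EuclideanSpace.single (r l) (1 : ℝ)) := by
  rw [← form_apply_sum η (fun l a => v l a) fun a => EuclideanSpace.single a (1 : ℝ)]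
  congr 1
  ext1 l
  exact model_eq_sum (v l)

variable {E : Type*} [NormedAddCommGroup E] [NormedSpace ℝ E] {s : Set E} {r : WithTop ℕ∞}

lemma contDiffOn_form_apply {η : E → Model n [⋀^Fin k]→L[ℝ] ℂ} {v : E → Fin k → Model n}
    (hη : ContDiffOn ℝ r η s) (hv : ∀ l, ContDiffOn ℝ r (fun y => v y l) s) :
    ContDiffOn ℝ r (fun y => η y (v y)) s := by
  simp_rw [fun y => form_apply_eq_sum (η y) (v y)]
  refine ContDiffOn.sum fun a _ => ContDiffOn.fun_smul (contDiffOn_prod fun l _ => ?_) ?_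
  · exact (EuclideanSpace.proj (𝕜 := ℝ) (a l)).contDiff.comp_contDiffOn (hv l)
  · let A : (Model n [⋀^Fin k]→L[ℝ] ℂ) →L[ℝ] ℂ :=
      ContinuousAlternatingMap.apply ℝ (Model n) ℂ (fun l => EuclideanSpace.single (a l) (1 : ℝ))
    exact A.contDiff.comp_contDiffOn hη

/-- The components of a form in the standard basis. -/
noncomputable def formComponents (n k : ℕ) :
    (Model n [⋀^Fin k]→L[ℝ] ℂ) →ₗ[ℝ] ((Fin k → Fin (2 * n)) → ℂ) where
  toFun η a := η (fun l => EuclideanSpace.single (a l) (1 : ℝ))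
  map_add' _ _ := rfl
  map_smul' _ _ := rfl

lemma contDiffOn_form {η : E → Model n [⋀^Fin k]→L[ℝ] ℂ}
    (h : ∀ v : Fin k → Model n, ContDiffOn ℝ r (fun y => η y v) s) : ContDiffOn ℝ r η s := by
  -- A linear left inverse recovers a form from its components; its domain is finite-dimensional, so
  -- it is continuous and preserves smoothness.
  obtain ⟨R, hR⟩ := (formComponents n k).exists_leftInverse_of_injective
    (LinearMap.ker_eq_bot.mpr fun η ζ hηζ => form_ext_single fun a => congrFun hηζ a)
  have h1 : ContDiffOn ℝ r (fun y => formComponents n k (η y)) s :=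
    contDiffOn_pi.mpr fun a => h _
  have h2 := (LinearMap.toContinuousLinearMap R).contDiff.comp_contDiffOn (n := r) h1
  refine h2.congr fun y _ => ?_
  exact (LinearMap.congr_fun hR (η y)).symm

end Components

/-! ### Type components: naturality and smoothness -/

section TypePart

variable {V W : Type*} [AddCommGroup V] [Module ℝ V] [TopologicalSpace V]
  [ContinuousConstSMul ℝ V] [AddCommGroup W] [Module ℝ W] [TopologicalSpace W]
  [ContinuousConstSMul ℝ W]

lemma typePart_apply (J : V →L[ℝ] V) (p : ℕ) {k : ℕ} (η : V [⋀^Fin k]→L[ℝ] ℂ) (v : Fin k → V) :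
    typePart J p η v = ∑ S ∈ (Finset.univ : Finset (Fin k)).powersetCard p,
      ∑ T : Finset (Fin k), (Complex.I ^ T.card) • η (fun j =>
        if j ∈ T then (if j ∈ S then (-(1 / 2) : ℝ) else (1 / 2 : ℝ)) • J (v j)
        else (1 / 2 : ℝ) • v j) := by
  have h : typePart J p η v =
      (∑ S ∈ (Finset.univ : Finset (Fin k)).powersetCard p, bidegreePart J S η) v := rfl
  rw [h, sum_apply]
  refine Finset.sum_congr rfl fun S _ => ?_
  rw [bidegreePart, sum_apply]
  refine Finset.sum_congr rfl fun T _ => ?_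
  rw [smul_apply]
  congr 1
  refine congrArg η (funext fun j => ?_)
  by_cases hT : j ∈ T <;> by_cases hS : j ∈ S <;> simp [hT, hS]

/-- Used with `A = coordFrame c y`, to carry the projection onto types into a chart. -/
lemma typePart_compContinuousLinearMap {J : V →L[ℝ] V} {J' : W →L[ℝ] W} {A : W →L[ℝ] V}
    (h : ∀ w, J (A w) = A (J' w)) (p : ℕ) {k : ℕ} (η : V [⋀^Fin k]→L[ℝ] ℂ) :
    (typePart J p η).compContinuousLinearMap A = typePart J' p (η.compContinuousLinearMap A) := by
  ext v
  rw [ContinuousAlternatingMap.compContinuousLinearMap_apply, typePart_apply, typePart_apply]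
  refine Finset.sum_congr rfl fun S _ => Finset.sum_congr rfl fun T _ => ?_
  rw [ContinuousAlternatingMap.compContinuousLinearMap_apply]
  congr 1
  refine congrArg η (funext fun j => ?_)
  simp only [Function.comp_apply, h]
  split_ifs <;> simp

lemma contDiffOn_typePart {n k : ℕ} {E : Type*} [NormedAddCommGroup E] [NormedSpace ℝ E]
    {s : Set E} {r : WithTop ℕ∞} {J : E → Model n →L[ℝ] Model n}
    {η : E → Model n [⋀^Fin k]→L[ℝ] ℂ} (p : ℕ) (hJ : ∀ v, ContDiffOn ℝ r (fun y => J y v) s)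
    (hη : ContDiffOn ℝ r η s) : ContDiffOn ℝ r (fun y => typePart (J y) p (η y)) s := by
  refine contDiffOn_form fun v => ?_
  simp_rw [typePart_apply]
  refine ContDiffOn.sum fun S _ => ContDiffOn.sum fun T _ => ContDiffOn.const_smul _ ?_
  refine contDiffOn_form_apply hη fun l => ?_
  split_ifs
  · exact (hJ _).const_smul _
  · exact (hJ _).const_smul _
  · exact contDiffOn_const

end TypePart

/-! ### The pointwise Hermitian product: symmetry, scaling, positivity -/

section CoordInner

variable {n k : ℕ} {G : Matrix (Fin (2 * n)) (Fin (2 * n)) ℝ}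

lemma conj_coordInner (hG : G.transpose = G) (η ζ : Model n [⋀^Fin k]→L[ℝ] ℂ) :
    (starRingEnd ℂ) (coordInner G η ζ) = coordInner G ζ η := by
  have hG' : ∀ a b, G⁻¹ a b = G⁻¹ b a := fun a b => by
    conv_lhs => rw [← hG, ← Matrix.transpose_nonsing_inv, Matrix.transpose_apply]
  unfold coordInner
  simp only [map_mul, map_inv₀, map_sum, Complex.conj_conj, Complex.conj_ofReal, map_natCast]
  congr 1
  rw [Finset.sum_comm]
  refine Finset.sum_congr rfl fun a _ => Finset.sum_congr rfl fun b _ => ?_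
  rw [Finset.prod_congr rfl fun l _ => hG' (b l) (a l)]
  ring

lemma coordInner_zero_right (η : Model n [⋀^Fin k]→L[ℝ] ℂ) : coordInner G η 0 = 0 := by
  simp [coordInner]

lemma coordInner_neg_right (η ζ : Model n [⋀^Fin k]→L[ℝ] ℂ) :
    coordInner G η (-ζ) = -coordInner G η ζ := by
  simp [coordInner]

/-- Each of the `k` index pairs contributes one entry of the inverse matrix, hence one factor `t⁻¹`.
-/
lemma coordInner_smul {t : ℝ} (ht : t ≠ 0) (η ζ : Model n [⋀^Fin k]→L[ℝ] ℂ) :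
    coordInner (t • G) η ζ = ((t ^ k)⁻¹ : ℝ) * coordInner G η ζ := by
  have h : (t • G)⁻¹ = t⁻¹ • G⁻¹ := by
    by_cases hG : IsUnit G.det
    · exact Matrix.inv_smul' G (Units.mk0 t ht) hG
    -- For singular `G` both inverses are zero by convention.
    · rw [Matrix.nonsing_inv_apply_not_isUnit _ hG, Matrix.nonsing_inv_apply_not_isUnit, smul_zero]
      rw [Matrix.det_smul]
      simpa [ht] using hG
  unfold coordInner
  simp only [h, Matrix.smul_apply, smul_eq_mul, Finset.prod_mul_distrib, Finset.prod_const,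
    Finset.card_univ, Fintype.card_fin]
  rw [mul_left_comm]
  congr 1
  rw [Finset.mul_sum]
  refine Finset.sum_congr rfl fun a _ => ?_
  rw [Finset.mul_sum]
  refine Finset.sum_congr rfl fun b _ => ?_
  push_cast
  rw [inv_pow]
  ring

/-- When `B` is invertible its rows form a `G`-orthonormal frame, and the product becomes the sum of
the squared components in that frame. Positivity and definiteness are read off from this. -/
lemma coordInner_self_eq_sum {B : Matrix (Fin (2 * n)) (Fin (2 * n)) ℝ}
    (hB : G⁻¹ = B.transpose * B) (η : Model n [⋀^Fin k]→L[ℝ] ℂ) :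
    coordInner G η η = (((k.factorial : ℝ)⁻¹ * ∑ c : Fin k → Fin (2 * n),
      Complex.normSq (η (fun l => ∑ a, B (c l) a • (EuclideanSpace.single a (1 : ℝ) : Model n))) :
        ℝ) : ℂ) := by
  have hprod : ∀ a b : Fin k → Fin (2 * n), ∏ l, G⁻¹ (a l) (b l) =
      ∑ c : Fin k → Fin (2 * n), (∏ l, B (c l) (a l)) * ∏ l, B (c l) (b l) := fun a b => by
    simp only [hB, Matrix.mul_apply, Matrix.transpose_apply]
    rw [Finset.prod_univ_sum, Fintype.piFinset_univ]
    simp only [Finset.prod_mul_distrib]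
  unfold coordInner
  rw [Complex.ofReal_mul, Complex.ofReal_inv, Complex.ofReal_natCast, Complex.ofReal_sum]
  congr 1
  simp_rw [hprod]
  simp only [← Complex.mul_conj, Complex.ofReal_sum]
  simp_rw [fun c : Fin k → Fin (2 * n) => form_apply_sum η (fun l a => B (c l) a)
    (fun a => (EuclideanSpace.single a (1 : ℝ) : Model n)), map_sum, Finset.sum_mul_sum,
    Finset.sum_mul]
  rw [Finset.sum_congr rfl fun a _ => Finset.sum_comm, Finset.sum_comm]
  refine Finset.sum_congr rfl fun c _ => Finset.sum_congr rfl fun a _ =>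
    Finset.sum_congr rfl fun b _ => ?_
  simp only [Complex.real_smul, map_mul, Complex.conj_ofReal]
  push_cast
  ring

lemma exists_inv_eq_transpose_mul_self (hG : G.PosDef) :
    ∃ B : Matrix (Fin (2 * n)) (Fin (2 * n)) ℝ, G⁻¹ = B.transpose * B ∧ IsUnit B.det := by
  open scoped MatrixOrder in
  obtain ⟨B, hB⟩ := CStarAlgebra.nonneg_iff_eq_star_mul_self.mp
    (Matrix.nonneg_iff_posSemidef.mpr hG.inv.posSemidef)
  have hB' : G⁻¹ = B.transpose * B := by
    rw [hB, Matrix.star_eq_conjTranspose, Matrix.conjTranspose_eq_transpose_of_trivial]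
  refine ⟨B, hB', ?_⟩
  have hdet : G⁻¹.det ≠ 0 := hG.inv.det_pos.ne'
  rw [hB', Matrix.det_mul] at hdet
  exact isUnit_iff_ne_zero.mpr (right_ne_zero_of_mul hdet)

lemma coordInner_self_eq_ofReal (hG : G.PosDef) (η : Model n [⋀^Fin k]→L[ℝ] ℂ) :
    coordInner G η η = ((coordInner G η η).re : ℂ) := by
  obtain ⟨B, hB, -⟩ := exists_inv_eq_transpose_mul_self hG
  rw [coordInner_self_eq_sum hB, Complex.ofReal_re]

lemma coordInner_self_re_nonneg (hG : G.PosDef) (η : Model n [⋀^Fin k]→L[ℝ] ℂ) :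
    0 ≤ (coordInner G η η).re := by
  obtain ⟨B, hB, -⟩ := exists_inv_eq_transpose_mul_self hG
  rw [coordInner_self_eq_sum hB, Complex.ofReal_re]
  exact mul_nonneg (by positivity) (Finset.sum_nonneg fun c _ => Complex.normSq_nonneg _)

lemma eq_zero_of_coordInner_self_re_eq_zero (hG : G.PosDef) {η : Model n [⋀^Fin k]→L[ℝ] ℂ}
    (h : (coordInner G η η).re = 0) : η = 0 := by
  obtain ⟨B, hB, hBu⟩ := exists_inv_eq_transpose_mul_self hG
  rw [coordInner_self_eq_sum hB, Complex.ofReal_re, mul_eq_zero,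
    Finset.sum_eq_zero_iff_of_nonneg fun c _ => Complex.normSq_nonneg _] at h
  replace h := h.resolve_left (by positivity)
  refine form_ext_single fun a => ?_
  -- `B⁻¹` expresses the standard basis in the frame given by the rows of `B`, on which `η`
  -- vanishes.
  have key : ∀ a : Fin (2 * n), (EuclideanSpace.single a (1 : ℝ) : Model n) =
      ∑ c, B⁻¹ a c • ∑ b, B c b • (EuclideanSpace.single b (1 : ℝ) : Model n) := fun a => by
    simp only [Finset.smul_sum, smul_smul]
    rw [Finset.sum_comm]
    simp only [← Finset.sum_smul, ← Matrix.mul_apply, Matrix.nonsing_inv_mul B hBu,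
      Matrix.one_apply, ite_smul, one_smul, zero_smul, Finset.sum_ite_eq, Finset.mem_univ, if_true]
  rw [funext fun l => key (a l), form_apply_sum η (fun l c => B⁻¹ (a l) c)]
  refine Finset.sum_eq_zero fun c _ => ?_
  rw [Complex.normSq_eq_zero.mp (h c (Finset.mem_univ c)), smul_zero]

lemma continuousOn_coordInner {X : Type*} [TopologicalSpace X] {s : Set X}
    {G : X → Matrix (Fin (2 * n)) (Fin (2 * n)) ℝ} {η ζ : X → Model n [⋀^Fin k]→L[ℝ] ℂ}
    (hG : ContinuousOn G s) (hdet : ∀ y ∈ s, (G y).det ≠ 0) (hη : ContinuousOn η s)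
    (hζ : ContinuousOn ζ s) : ContinuousOn (fun y => coordInner (G y) (η y) (ζ y)) s := by
  have hinv : ContinuousOn (fun y => (G y)⁻¹) s := by
    simp only [Matrix.inv_def, Ring.inverse_eq_inv']
    exact ((continuous_id.matrix_det.comp_continuousOn hG).inv₀ hdet).smul
      (continuous_id.matrix_adjugate.comp_continuousOn hG)
  have happ : ∀ v : Fin k → Model n, Continuous fun ξ : Model n [⋀^Fin k]→L[ℝ] ℂ => ξ v := fun v =>
    (ContinuousAlternatingMap.apply ℝ (Model n) ℂ v).continuous
  unfold coordInner
  refine continuousOn_const.mul (continuousOn_finsetSum _ fun a _ =>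
    continuousOn_finsetSum _ fun b _ => ?_)
  refine ((Complex.continuous_ofReal.comp_continuousOn (continuousOn_finsetProd _ fun l _ => ?_)).mul
    ((happ _).comp_continuousOn hη)).mul
    (Complex.continuous_conj.comp_continuousOn ((happ _).comp_continuousOn hζ))
  exact ((continuous_apply_apply (a l) (b l)).comp_continuousOn hinv :)

end CoordInner

end AlmostHermitian

/-! ### The metric and the almost-complex structure in charts -/

namespace AlmostHermitian

variable {n : ℕ} {M : Type*} [TopologicalSpace M] [ChartedSpace (Model n) M]

section Frame

variable [IsManifold (𝓡 (2 * n)) ∞ M]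

/-- The differential at `x` of the chart at `c`, the inverse of `coordFrame`. -/
noncomputable def coordCoframe (c x : M) : TangentSpace (𝓡 (2 * n)) x →L[ℝ] Model n :=
  mfderiv (𝓡 (2 * n)) (𝓡 (2 * n)) (chartAt (Model n) c) x

lemma mdifferentiable_chart (c : M) : (chartAt (Model n) c).MDifferentiable (𝓡 (2 * n)) (𝓡 (2 * n)) :=
  have : IsManifold (𝓡 (2 * n)) 1 M := IsManifold.of_le (n := ∞) (by norm_num)
  _root_.mdifferentiable_chart c

lemma coordCoframe_coordFrame (c : M) {y : Model n} (hy : y ∈ (chartAt (Model n) c).target)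
    (v : Model n) : coordCoframe c ((chartAt (Model n) c).symm y) (coordFrame c y v) = v := by
  have h := (mdifferentiable_chart c).comp_symm_deriv hy
  exact DFunLike.congr_fun h v

lemma coordFrame_coordCoframe (c : M) {y : Model n} (hy : y ∈ (chartAt (Model n) c).target)
    (v : TangentSpace (𝓡 (2 * n)) ((chartAt (Model n) c).symm y)) :
    coordFrame c y (coordCoframe c ((chartAt (Model n) c).symm y) v) = v := by
  have h := (mdifferentiable_chart c).symm_comp_deriv ((chartAt (Model n) c).map_target hy)
  rw [(chartAt (Model n) c).right_inv hy] at h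
  exact DFunLike.congr_fun h v

lemma coordFrame_injective (c : M) {y : Model n} (hy : y ∈ (chartAt (Model n) c).target) :
    Function.Injective (coordFrame c y) :=
  Function.LeftInverse.injective (coordCoframe_coordFrame c hy)

/-- The tangent map of the inverse chart is applied to a constant vector field on the model space.
-/
lemma contMDiffOn_coordFrame (c : M) (v : Model n) :
    ContMDiffOn 𝓘(ℝ, Model n) (𝓡 (2 * n)).tangent ∞
      (fun y => (⟨(chartAt (Model n) c).symm y, coordFrame c y v⟩ : TangentBundle (𝓡 (2 * n)) M))
      (chartAt (Model n) c).target := by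
  have : IsManifold (𝓡 (2 * n)) 1 M := IsManifold.of_le (n := ∞) (by norm_num)
  have h := (contMDiffOn_chart_symm (I := 𝓡 (2 * n)) (n := ∞) (x := c)).contMDiffOn_tangentMapWithin
    (m := ∞) (by norm_num) (chartAt (Model n) c).open_target.uniqueMDiffOn
  have hs : ContMDiff 𝓘(ℝ, Model n) (𝓡 (2 * n)).tangent ∞
      (fun y => (⟨y, v⟩ : TangentBundle (𝓡 (2 * n)) (Model n))) := by
    refine contMDiffOn_univ.mp ?_
    exact contMDiffOn_vectorSpace_iff_contDiffOn.mpr contDiffOn_const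
  refine (h.comp hs.contMDiffOn (fun y hy => hy)).congr fun y hy => ?_
  simp only [Function.comp_apply, tangentMapWithin]
  rw [mfderivWithin_of_isOpen (chartAt (Model n) c).open_target hy]
  rfl

lemma contDiffOn_metric (c : M)
    (g : Bundle.ContMDiffRiemannianMetric (𝓡 (2 * n)) ∞ (Model n)
      (fun x : M => TangentSpace (𝓡 (2 * n)) x)) (u v : Model n) :
    ContDiffOn ℝ ∞ (fun y => g.inner ((chartAt (Model n) c).symm y) (coordFrame c y u)
      (coordFrame c y v)) (chartAt (Model n) c).target := by
  have hF := fun w : Model n => contMDiffOn_coordFrame (M := M) c w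
  have hg := g.contMDiff.comp_contMDiffOn (contMDiffOn_chart_symm (M := M) (I := 𝓡 (2 * n)) (n := ∞) (x := c))
  intro y hy
  have h := ContMDiffWithinAt.clm_bundle_apply₂ (F₁ := Model n) (F₂ := Model n) (F₃ := ℝ)
    (E₃ := Bundle.Trivial M ℝ) (hg y hy) (hF u y hy) (hF v y hy)
  rw [Bundle.contMDiffWithinAt_totalSpace] at h
  exact h.2.contDiffWithinAt

/-- The almost-complex structure in the chart at `c`. -/
noncomputable def AlmostComplexStructure.inChart (J : AlmostComplexStructure n M) (c : M) (y : Model n) :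
    Model n →L[ℝ] Model n :=
  (coordCoframe c ((chartAt (Model n) c).symm y)).comp
    ((J.toFun ((chartAt (Model n) c).symm y)).comp (coordFrame c y))

/-- The smooth field `J (coordFrame c y v)` is pushed forward by the tangent map of the chart, and
its fibre component is taken. -/
lemma AlmostComplexStructure.contDiffOn_inChart (J : AlmostComplexStructure n M) (c : M)
    (v : Model n) :
    ContDiffOn ℝ ∞ (fun y => J.inChart c y v) (chartAt (Model n) c).target := by
  have : IsManifold (𝓡 (2 * n)) 1 M := IsManifold.of_le (n := ∞) (by norm_num)
  have hJ := J.smooth.comp_contMDiffOn (contMDiffOn_chart_symm (I := 𝓡 (2 * n)) (n := ∞) (x := c))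
  have hs : ContMDiffOn 𝓘(ℝ, Model n) (𝓡 (2 * n)).tangent ∞
      (fun y => (⟨(chartAt (Model n) c).symm y,
        J.toFun ((chartAt (Model n) c).symm y) (coordFrame c y v)⟩ : TangentBundle (𝓡 (2 * n)) M))
      (chartAt (Model n) c).target := fun y hy =>
    ContMDiffWithinAt.clm_bundle_apply (F₁ := Model n) (F₂ := Model n)
      (hJ y hy) (contMDiffOn_coordFrame c v y hy)
  have ht := (contMDiffOn_chart (I := 𝓡 (2 * n)) (n := ∞) (x := c)).contMDiffOn_tangentMapWithin
    (m := ∞) (by norm_num) (chartAt (Model n) c).open_source.uniqueMDiffOn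
  have h := ht.comp hs (fun y hy => (chartAt (Model n) c).map_target hy)
  have h' := (contMDiff_snd_tangentBundle_modelSpace (n := ∞) (Model n) (𝓡 (2 * n))).comp_contMDiffOn h
  refine h'.contDiffOn.congr fun y hy => ?_
  have hd : mfderivWithin (𝓡 (2 * n)) (𝓡 (2 * n)) (chartAt (Model n) c) (chartAt (Model n) c).source
      ((chartAt (Model n) c).symm y) = coordCoframe c ((chartAt (Model n) c).symm y) :=
    mfderivWithin_of_isOpen (chartAt (Model n) c).open_source ((chartAt (Model n) c).map_target hy)
  exact (DFunLike.congr_fun hd (J.toFun _ (coordFrame c y v))).symm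

lemma HermitianMetric.contDiffOn_gram_apply {J : AlmostComplexStructure n M} (g : HermitianMetric J)
    (c : M) (i j : Fin (2 * n)) :
    ContDiffOn ℝ ∞ (fun y => g.gram c y i j) (chartAt (Model n) c).target :=
  contDiffOn_metric c g.toContMDiffRiemannianMetric _ _

lemma HermitianMetric.continuousOn_gram {J : AlmostComplexStructure n M} (g : HermitianMetric J)
    (c : M) : ContinuousOn (g.gram c) (chartAt (Model n) c).target :=
  continuousOn_pi.mpr fun i => continuousOn_pi.mpr fun j => (g.contDiffOn_gram_apply c i j).continuousOn

lemma HermitianMetric.posDef_gram {J : AlmostComplexStructure n M} (g : HermitianMetric J)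
    (c : M) {y : Model n} (hy : y ∈ (chartAt (Model n) c).target) : (g.gram c y).PosDef := by
  refine Matrix.PosDef.of_dotProduct_mulVec_pos ?_ fun v hv => ?_
  · ext i j
    exact g.symm _ _ _
  · have hw : (WithLp.toLp 2 v : Model n) ≠ 0 := fun h => hv (congrArg WithLp.ofLp h)
    have hpos := g.pos _ (coordFrame c y (WithLp.toLp 2 v))
      ((map_ne_zero_iff _ (coordFrame_injective c hy)).mpr hw)
    have hsum : coordFrame c y (WithLp.toLp 2 v) =
        ∑ a, v a • coordFrame c y (EuclideanSpace.single a (1 : ℝ)) := by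
      rw [model_eq_sum (WithLp.toLp 2 v), map_sum]
      simp only [map_smul]
    refine hpos.trans_eq ?_
    rw [hsum]
    simp only [map_sum, map_smul, sum_apply, smul_apply, smul_eq_mul, dotProduct, Matrix.mulVec,
      Finset.mul_sum, star_trivial]
    rw [Finset.sum_comm]
    refine Finset.sum_congr rfl fun i _ => Finset.sum_congr rfl fun j _ => ?_
    simp only [HermitianMetric.gram, Matrix.of_apply]
    ring

namespace HermitianMetric

variable {J : AlmostComplexStructure n M}

lemma transpose_gram (g : HermitianMetric J) (c : M) (y : Model n) : (g.gram c y).transpose = g.gram c y := by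
  ext i j
  exact g.symm _ _ _

lemma gram_eq_smul_of_fundamentalForm
    {g g' : HermitianMetric J} {Φ : M → ℝ}
    (h : ∀ (x : M) (u v : TangentSpace (𝓡 (2 * n)) x),
      g'.fundamentalForm x u v = Φ x * g.fundamentalForm x u v) (c : M) (y : Model n) :
    g'.gram c y = Φ ((chartAt (Model n) c).symm y) • g.gram c y := by
  have hinner : ∀ (x : M) (u v : TangentSpace (𝓡 (2 * n)) x),
      g'.inner x u v = Φ x * g.inner x u v := fun x u v => by
    -- Since `J (J (-u)) = u`, the metric is recovered as `g(u, v) = ω(J (-u), v)`.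
    have hu := h x (J.toFun x (-u)) v
    simpa only [fundamentalForm, J.sq_eq, neg_neg] using hu
  ext i j
  exact hinner _ _ _

end HermitianMetric

end Frame

end AlmostHermitian

/-! ### Exterior derivative in charts and smoothness of `∂̄` -/

namespace AlmostHermitian

variable {n : ℕ} {M : Type*} [TopologicalSpace M] [ChartedSpace (Model n) M]

section Forms

variable {k : ℕ}

lemma Form.inChart_zero (c : M) (y : Model n) : (0 : Form n M k).inChart c y = 0 := rfl

lemma Form.inChart_neg (η : Form n M k) (c : M) (y : Model n) :
    (-η).inChart c y = -η.inChart c y := rfl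

lemma Form.inChart_sum {ι : Type*} (s : Finset ι) (f : ι → Form n M k) (c : M) (y : Model n) :
    (∑ i ∈ s, f i).inChart c y = ∑ i ∈ s, (f i).inChart c y := by
  classical
  induction s using Finset.induction_on with
  | empty => rfl
  | insert a s ha ih => rw [Finset.sum_insert ha, Finset.sum_insert ha, ← ih]; rfl

lemma Form.isSmooth_zero : (0 : Form n M k).IsSmooth := fun c =>
  contDiffOn_const (c := (0 : Model n [⋀^Fin k]→L[ℝ] ℂ)) (s := (chartAt (Model n) c).target)

lemma Form.d_zero : (0 : Form n M k).d = 0 := funext fun x => by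
  have h : (0 : Form n M k).inChart x = fun _ => 0 := rfl
  have h' : extDeriv (fun _ : Model n => (0 : Model n [⋀^Fin k]→L[ℝ] ℂ))
      (chartAt (Model n) x x) = 0 := by
    ext v
    simp [extDeriv, ContinuousAlternatingMap.alternatizeUncurryFin_apply]
  rw [Form.d, h, h']
  rfl

lemma Form.comp_mfderiv_congr (η : Form n M k) {f f' : Model n → M} {y : Model n}
    (h : f =ᶠ[𝓝 y] f') :
    (η (f y)).compContinuousLinearMap (mfderiv (𝓡 (2 * n)) (𝓡 (2 * n)) f y) =
      (η (f' y)).compContinuousLinearMap (mfderiv (𝓡 (2 * n)) (𝓡 (2 * n)) f' y) := by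
  -- All tangent spaces unfold to `Model n`, so with `A` typed on the model the base point can be
  -- substituted.
  have hA : ∀ {z z' : M} (_ : z = z') (A : Model n →L[ℝ] Model n),
      ContinuousAlternatingMap.compContinuousLinearMap (M' := Model n) (η z) A =
        ContinuousAlternatingMap.compContinuousLinearMap (M' := Model n) (η z') A := by
    rintro z _ rfl A
    rfl
  have hd : (mfderiv (𝓡 (2 * n)) (𝓡 (2 * n)) f y : Model n →L[ℝ] Model n) =
      mfderiv (𝓡 (2 * n)) (𝓡 (2 * n)) f' y := h.mfderiv_eq
  refine (hA h.eq_of_nhds _).trans ?_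
  exact congrArg (ContinuousAlternatingMap.compContinuousLinearMap (M' := Model n) (η (f' y))) hd

variable [IsManifold (𝓡 (2 * n)) ∞ M]

lemma Form.inChart_eq_zero_iff (η : Form n M k) (c : M) {y : Model n}
    (hy : y ∈ (chartAt (Model n) c).target) :
    η.inChart c y = 0 ↔ η ((chartAt (Model n) c).symm y) = 0 := by
  refine ⟨fun h => ?_, fun h => by rw [Form.inChart, h]; rfl⟩
  ext v
  have h' := DFunLike.congr_fun h
    (fun l => coordCoframe c ((chartAt (Model n) c).symm y) (v l))
  refine Eq.trans (congrArg _ (funext fun l => ?_)) h'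
  exact (coordFrame_coordCoframe c hy (v l)).symm

/-- The exterior derivative can be computed in any chart. -/
lemma Form.inChart_d {η : Form n M k} (hη : η.IsSmooth) (c : M) {y : Model n}
    (hy : y ∈ (chartAt (Model n) c).target) :
    η.d.inChart c y = extDeriv (η.inChart c) y := by
  set x := (chartAt (Model n) c).symm y with hx
  set ψ := chartAt (Model n) x with hψ
  set e := chartAt (Model n) c with he
  set τ : Model n → Model n := ψ ∘ e.symm with hτ
  have hxψ : x ∈ ψ.source := mem_chart_source _ x
  have hU : ∀ᶠ y' in 𝓝 y, y' ∈ e.target ∧ e.symm y' ∈ ψ.source :=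
    (e.open_target.eventually_mem hy).and
      ((e.continuousAt_symm hy).eventually_mem (ψ.open_source.mem_nhds hxψ))
  have hfd : ∀ y' ∈ e.target, e.symm y' ∈ ψ.source → fderiv ℝ τ y' =
      (mfderiv (𝓡 (2 * n)) (𝓡 (2 * n)) ψ (e.symm y')).comp (coordFrame c y') :=
    fun y' hy' hy'' => by
      rw [← mfderiv_eq_fderiv]
      exact mfderiv_comp y' ((mdifferentiable_chart x).mdifferentiableAt hy'')
        ((mdifferentiable_chart c).mdifferentiableAt_symm hy')
  have hcd : ContDiffAt ℝ ∞ τ y := by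
    have h1 := (contMDiffOn_chart_symm (I := 𝓡 (2 * n)) (n := ∞) (x := c)).contMDiffAt
      (e.open_target.mem_nhds hy)
    have h2 := (contMDiffOn_chart (I := 𝓡 (2 * n)) (n := ∞) (x := x)).contMDiffAt
      (ψ.open_source.mem_nhds hxψ)
    exact (h2.comp y h1).contDiffAt
  -- `extDeriv` commutes with pullback by the transition map `τ` from the chart at `c` to the chart
  -- at `x`, the chart in which `d` is defined at `x`.
  have hpull := extDeriv_pullback (𝕜 := ℝ) (f := τ) (x := y) (r := ∞)
    (((hη x).contDiffAt (ψ.open_target.mem_nhds (ψ.map_source hxψ))).differentiableAt (by simp))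
    hcd (by rw [minSmoothness_of_isRCLikeNormedField]; exact WithTop.coe_le_coe.mpr (le_top : (2 : ℕ∞) ≤ ⊤))
  -- Near `y`, pulling the expression at `x` back by `τ` gives the expression at `c`, because
  -- `ψ.symm ∘ τ` agrees locally with `e.symm`.
  have hev : (fun y' => (η.inChart x (τ y')).compContinuousLinearMap (fderiv ℝ τ y'))
      =ᶠ[𝓝 y] η.inChart c := by
    filter_upwards [hU] with y' hy'
    have hev' : ψ.symm ∘ τ =ᶠ[𝓝 y'] e.symm := by
      filter_upwards [e.open_target.eventually_mem hy'.1, (e.continuousAt_symm hy'.1).eventually_mem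
        (ψ.open_source.mem_nhds hy'.2)] with z _ hz
      exact ψ.left_inv hz
    have hτd : MDifferentiableAt (𝓡 (2 * n)) (𝓡 (2 * n)) τ y' :=
      MDifferentiableAt.comp y' ((mdifferentiable_chart x).mdifferentiableAt hy'.2)
        ((mdifferentiable_chart c).mdifferentiableAt_symm hy'.1)
    have hcomp := mfderiv_comp y' ((mdifferentiable_chart x).mdifferentiableAt_symm
      (ψ.map_source hy'.2)) hτd
    rw [mfderiv_eq_fderiv] at hcomp
    refine Eq.trans ?_ (η.comp_mfderiv_congr hev')
    rw [hcomp]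
    rfl
  rw [← hev.extDeriv_eq, hpull, hfd y hy hxψ]
  rfl

variable (J : AlmostComplexStructure n M)

lemma Form.inChart_part (p : ℕ) (η : Form n M k) (c : M) {y : Model n}
    (hy : y ∈ (chartAt (Model n) c).target) :
    (η.part J p).inChart c y = typePart (J.inChart c y) p (η.inChart c y) :=
  typePart_compContinuousLinearMap (fun _ => (coordFrame_coordCoframe c hy _).symm) p _

variable {J}

lemma Form.IsSmooth.part {η : Form n M k} (hη : η.IsSmooth) (p : ℕ) : (η.part J p).IsSmooth :=
  fun c => (contDiffOn_typePart p (J.contDiffOn_inChart c) (hη c)).congr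
    fun _ hy => Form.inChart_part J p η c hy

lemma Form.IsSmooth.d {η : Form n M k} (hη : η.IsSmooth) : η.d.IsSmooth := fun c => by
  have h : ContDiffOn ℝ ∞ (extDeriv (η.inChart c)) (chartAt (Model n) c).target := by
    have h1 : ContDiffOn ℝ ∞ (fderiv ℝ (η.inChart c)) (chartAt (Model n) c).target :=
      (hη c).fderiv_of_isOpen (chartAt (Model n) c).open_target (by simp)
    exact (ContinuousAlternatingMap.alternatizeUncurryFinCLM ℝ (Model n) ℂ).contDiff.comp_contDiffOn h1
  exact h.congr fun _ hy => Form.inChart_d hη c hy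

lemma Form.IsSmooth.dbar {η : Form n M k} (hη : η.IsSmooth) : (η.dbar J).IsSmooth := fun c => by
  have h : ContDiffOn ℝ ∞ (fun y => ∑ p ∈ Finset.range (k + 1),
      (((η.part J p).d).part J p).inChart c y) (chartAt (Model n) c).target :=
    ContDiffOn.sum fun p _ => ((hη.part p).d.part p) c
  exact h.congr fun y _ => Form.inChart_sum _ _ c y

lemma typePart_zero {V : Type*} [AddCommGroup V] [Module ℝ V] [TopologicalSpace V]
    [ContinuousConstSMul ℝ V] (J : V →L[ℝ] V) (p : ℕ) :
    typePart J p (0 : V [⋀^Fin k]→L[ℝ] ℂ) = 0 := by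
  ext v
  simp [typePart_apply]

lemma Form.part_zero (p : ℕ) : (0 : Form n M k).part J p = 0 :=
  funext fun _ => typePart_zero _ p

lemma Form.dbar_zero : (0 : Form n M k).dbar J = 0 := by
  simp [Form.dbar, Form.part_zero, Form.d_zero]

end Forms

end AlmostHermitian

/-! ### The `L²` product and its definiteness on smooth forms -/

namespace AlmostHermitian

open MeasureTheory

variable {n : ℕ} {M : Type*} [TopologicalSpace M] [ChartedSpace (Model n) M]
  [IsManifold (𝓡 (2 * n)) ∞ M] [T2Space M] [CompactSpace M] {J : AlmostComplexStructure n M}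
  {k : ℕ}

lemma tsupport_chartPartition_subset (c : M) :
    tsupport (chartPartition n M c) ⊆ (chartAt (Model n) c).source :=
  Classical.choose_spec
    (SmoothPartitionOfUnity.exists_isSubordinate_chartAt_source (𝓡 (2 * n)) M) c

lemma finite_chartPartition_ne_zero :
    {c : M | (chartPartition n M c : M → ℝ) ≠ 0}.Finite := by
  refine (LocallyFinite.finite_nonempty_of_compact (chartPartition n M).locallyFinite).subset
    fun c hc => Function.support_nonempty_iff.mpr hc

namespace HermitianMetric

variable (g : HermitianMetric J)

lemma l2Inner_zero_right (η : Form n M k) : g.l2Inner η 0 = 0 := by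
  simp [l2Inner, Form.inChart_zero, coordInner_zero_right]

lemma l2Inner_neg_right (η ζ : Form n M k) : g.l2Inner η (-ζ) = -g.l2Inner η ζ := by
  simp only [l2Inner, Form.inChart_neg, coordInner_neg_right, mul_neg, integral_neg,
    finsum_neg_distrib]

lemma conj_l2Inner (η ζ : Form n M k) :
    (starRingEnd ℂ) (g.l2Inner η ζ) = g.l2Inner ζ η := by
  unfold l2Inner
  -- Injectivity of conjugation lets it pass through the `finsum` without a finiteness check.
  refine ((starRingEnd ℂ).toAddMonoidHom.map_finsum_of_injective star_injective _).trans ?_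
  refine finsum_congr fun c => ?_
  refine integral_conj.symm.trans (integral_congr_ae (Filter.Eventually.of_forall fun y => ?_))
  simp only [map_mul, Complex.conj_ofReal, conj_coordInner (g.transpose_gram c y)]

/-- The density of `|η|²` in the chart at `c`, weighted by the partition of unity. -/
noncomputable def l2Density (η : Form n M k) (c : M) (y : Model n) : ℝ :=
  chartPartition n M c ((chartAt (Model n) c).symm y) * √(g.gram c y).det *
    (coordInner (g.gram c y) (η.inChart c y) (η.inChart c y)).re

lemma l2Density_nonneg (η : Form n M k) (c : M) {y : Model n}
    (hy : y ∈ (chartAt (Model n) c).target) : 0 ≤ g.l2Density η c y :=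
  mul_nonneg (mul_nonneg ((chartPartition n M).nonneg _ _) (Real.sqrt_nonneg _))
    (coordInner_self_re_nonneg (g.posDef_gram c hy) _)

lemma integral_l2Density_nonneg (η : Form n M k) (c : M) :
    0 ≤ ∫ y in (chartAt (Model n) c).target, g.l2Density η c y :=
  setIntegral_nonneg (chartAt (Model n) c).open_target.measurableSet
    fun _ hy => g.l2Density_nonneg η c hy

lemma l2Inner_self (η : Form n M k) : g.l2Inner η η =
    ((∑ᶠ c : M, ∫ y in (chartAt (Model n) c).target, g.l2Density η c y : ℝ) : ℂ) := by
  refine Eq.trans (finsum_congr fun c => ?_)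
    (Complex.ofRealHom.toAddMonoidHom.map_finsum_of_injective Complex.ofReal_injective _).symm
  refine Eq.trans ?_ (integral_ofReal (𝕜 := ℂ))
  refine setIntegral_congr_fun (chartAt (Model n) c).open_target.measurableSet fun y hy => ?_
  simp only [l2Density]
  rw [coordInner_self_eq_ofReal (g.posDef_gram c hy)]
  push_cast
  rfl

lemma finsum_l2Density_nonneg (η : Form n M k) :
    0 ≤ ∑ᶠ c : M, ∫ y in (chartAt (Model n) c).target, g.l2Density η c y :=
  finsum_nonneg fun c => g.integral_l2Density_nonneg η c

lemma continuousOn_l2Density {η : Form n M k} (hη : η.IsSmooth) (c : M) :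
    ContinuousOn (g.l2Density η c) (chartAt (Model n) c).target := by
  refine ContinuousOn.mul (ContinuousOn.mul ?_ ?_) ?_
  · exact (chartPartition n M c).contMDiff.continuous.comp_continuousOn
      (chartAt (Model n) c).continuousOn_symm
  · exact Real.continuous_sqrt.comp_continuousOn
      (continuous_id.matrix_det.comp_continuousOn (g.continuousOn_gram c))
  · exact Complex.continuous_re.comp_continuousOn (continuousOn_coordInner (g.continuousOn_gram c)
      (fun y hy => (g.posDef_gram c hy).det_pos.ne') (hη c).continuousOn (hη c).continuousOn)

/-- The density is continuous and vanishes off the image of the support of the partition function, a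
compact subset of the chart target. -/
lemma integrableOn_l2Density {η : Form n M k} (hη : η.IsSmooth) (c : M) :
    IntegrableOn (g.l2Density η c) (chartAt (Model n) c).target := by
  set e := chartAt (Model n) c
  have hsub : tsupport (chartPartition n M c) ⊆ e.source := tsupport_chartPartition_subset c
  have hK : IsCompact (e '' tsupport (chartPartition n M c)) :=
    (isClosed_tsupport _).isCompact.image_of_continuousOn (e.continuousOn.mono hsub)
  have hKt : e '' tsupport (chartPartition n M c) ⊆ e.target := by
    rintro _ ⟨x, hx, rfl⟩
    exact e.map_source (hsub hx)
  refine (((g.continuousOn_l2Density hη c).mono hKt).integrableOn_compact hK).of_forall_sdiff_eq_zero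
    e.open_target.measurableSet fun y hy => ?_
  have hy' : chartPartition n M c (e.symm y) = 0 := by
    by_contra h
    exact hy.2 ⟨e.symm y, subset_tsupport _ h, e.right_inv hy.1⟩
  simp only [l2Density]
  rw [hy', zero_mul, zero_mul]

/-- All summands are nonnegative, so each integral vanishes; a continuous nonnegative density with
zero integral is zero throughout the chart. At every point some partition function is positive,
which forces `η` to vanish there. -/
lemma eq_zero_of_finsum_l2Density_eq_zero {η : Form n M k} (hη : η.IsSmooth)
    (h : ∑ᶠ c : M, ∫ y in (chartAt (Model n) c).target, g.l2Density η c y = 0) : η = 0 := by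
  have hfin : (Function.support fun c : M =>
      ∫ y in (chartAt (Model n) c).target, g.l2Density η c y).Finite := by
    refine (finite_chartPartition_ne_zero (n := n) (M := M)).subset fun c hc hc' => hc ?_
    refine integral_eq_zero_of_ae (Filter.Eventually.of_forall fun y => ?_)
    have := congrFun hc' ((chartAt (Model n) c).symm y)
    simp only [l2Density, this, Pi.zero_apply, zero_mul]
  have hI : ∀ c : M, ∫ y in (chartAt (Model n) c).target, g.l2Density η c y = 0 := fun c =>
    le_antisymm ((single_le_finsum c hfin fun c => g.integral_l2Density_nonneg η c).trans h.le)
      (g.integral_l2Density_nonneg η c)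
  have hzero : ∀ c : M, ∀ y ∈ (chartAt (Model n) c).target, g.l2Density η c y = 0 := fun c => by
    have hmeas := (chartAt (Model n) c).open_target.measurableSet
    have hae := (setIntegral_eq_zero_iff_of_nonneg_ae ((ae_restrict_iff' hmeas).mpr
      (Filter.Eventually.of_forall fun y hy => g.l2Density_nonneg η c hy))
      (g.integrableOn_l2Density hη c)).mp (hI c)
    exact Measure.eqOn_open_of_ae_eq hae (chartAt (Model n) c).open_target
      (g.continuousOn_l2Density hη c) continuousOn_const
  funext x
  obtain ⟨c, hc⟩ := (chartPartition n M).exists_pos_of_mem (Set.mem_univ x)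
  have hx : x ∈ (chartAt (Model n) c).source :=
    tsupport_chartPartition_subset c (subset_tsupport _ hc.ne')
  have hy := (chartAt (Model n) c).map_source hx
  have hpos := g.posDef_gram c hy
  have h0 := hzero c _ hy
  rw [l2Density, (chartAt (Model n) c).left_inv hx] at h0
  have h1 := (mul_eq_zero.mp h0).resolve_left
    (mul_pos hc (Real.sqrt_pos.mpr hpos.det_pos)).ne'
  have h2 := (Form.inChart_eq_zero_iff η c hy).mp (eq_zero_of_coordInner_self_re_eq_zero hpos h1)
  rwa [(chartAt (Model n) c).left_inv hx] at h2

/-! ### Harmonic forms as closed forms orthogonal to the image of `∂̄` -/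

lemma isDbarLaplacian_zero_iff {ψ : Form n M 0} (hψ : ψ.IsSmooth) :
    g.IsDbarLaplacian ψ 0 ↔ ψ.dbar J = 0 := by
  refine ⟨fun h => ?_, fun h => ⟨Form.isSmooth_zero, fun φ _ => ?_⟩⟩
  · refine g.eq_zero_of_finsum_l2Density_eq_zero hψ.dbar ?_
    have h' := h.2 ψ hψ
    rw [l2Inner_zero_right, l2Inner_self] at h'
    exact Complex.ofReal_eq_zero.mp h'
  · rw [h, l2Inner_zero_right, l2Inner_zero_right]

/-- With `α = ∂̄*ψ` and `β = ∂̄*∂̄ψ = -∂̄α`, testing `β` against `ψ` gives `‖∂̄ψ‖² = -⟨ψ, ∂̄α⟩ =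
-‖α‖²`, so both norms vanish. The adjoints are supplied by the definition of the Laplacian, so their
existence need not be proved. -/
lemma isDbarLaplacian_succ_iff {ψ : Form n M (k + 1)} (hψ : ψ.IsSmooth) :
    g.IsDbarLaplacian ψ 0 ↔
      ψ.dbar J = 0 ∧ ∀ φ : Form n M k, φ.IsSmooth → g.l2Inner (φ.dbar J) ψ = 0 := by
  constructor
  · rintro ⟨α, β, hα, hβ, hαβ⟩
    have hβ' : β = -α.dbar J := (neg_eq_of_add_eq_zero_right hαβ.symm).symm
    have h := hβ.2 ψ hψ
    rw [hβ', l2Inner_neg_right, ← g.conj_l2Inner (α.dbar J) ψ, hα.2 α hα.1, conj_l2Inner, l2Inner_self,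
      l2Inner_self, ← Complex.ofReal_neg, Complex.ofReal_inj] at h
    have h1 := g.finsum_l2Density_nonneg α
    have h2 := g.finsum_l2Density_nonneg (ψ.dbar J)
    refine ⟨g.eq_zero_of_finsum_l2Density_eq_zero hψ.dbar (by linarith), fun φ hφ => ?_⟩
    rw [hα.2 φ hφ, g.eq_zero_of_finsum_l2Density_eq_zero hα.1 (by linarith), l2Inner_zero_right]
  · rintro ⟨h, h'⟩
    -- Orthogonality says that `∂̄*ψ = 0`, and `∂̄ψ = 0` gives `∂̄*∂̄ψ = 0`.
    refine ⟨0, 0, ⟨Form.isSmooth_zero, fun φ hφ => ?_⟩, ⟨Form.isSmooth_zero, fun φ _ => ?_⟩, ?_⟩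
    · rw [h' φ hφ, l2Inner_zero_right]
    · rw [h, l2Inner_zero_right, l2Inner_zero_right]
    · rw [Form.dbar_zero, add_zero]

/-! ### Conformal change in the middle degree -/

variable {g} {g' : HermitianMetric J} {Φ : M → ℝ}

lemma l2Inner_eq_of_conformal (hΦ : ∀ x, 0 < Φ x)
    (h : ∀ (x : M) (u v : TangentSpace (𝓡 (2 * n)) x),
      g'.fundamentalForm x u v = Φ x * g.fundamentalForm x u v) (hk : k = n) (η ζ : Form n M k) :
    g'.l2Inner η ζ = g.l2Inner η ζ := by
  subst hk
  unfold l2Inner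
  refine finsum_congr fun c => congrArg (integral _) (funext fun y => ?_)
  have ht := hΦ ((chartAt (Model k) c).symm y)
  -- The integrands already agree: `√det` gains `√(Φ²ᵏ) = Φᵏ`, against `Φ⁻ᵏ` from the product of
  -- forms.
  rw [gram_eq_smul_of_fundamentalForm h, coordInner_smul ht.ne', Matrix.det_smul, Fintype.card_fin,
    Real.sqrt_mul (by positivity), pow_mul', Real.sqrt_sq (by positivity)]
  have ht' : ((Φ ((chartAt (Model k) c).symm y) : ℝ) : ℂ) ^ k ≠ 0 :=
    pow_ne_zero _ (Complex.ofReal_ne_zero.mpr ht.ne')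
  push_cast
  field_simp

lemma isDbarLaplacian_zero_iff_of_conformal (hΦ : ∀ x, 0 < Φ x)
    (h : ∀ (x : M) (u v : TangentSpace (𝓡 (2 * n)) x),
      g'.fundamentalForm x u v = Φ x * g.fundamentalForm x u v) (hk : k = n) {ψ : Form n M k}
    (hψ : ψ.IsSmooth) : g'.IsDbarLaplacian ψ 0 ↔ g.IsDbarLaplacian ψ 0 := by
  cases k with
  | zero => rw [isDbarLaplacian_zero_iff _ hψ, isDbarLaplacian_zero_iff _ hψ]
  | succ k =>
    rw [isDbarLaplacian_succ_iff _ hψ, isDbarLaplacian_succ_iff _ hψ]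
    -- Only products of `∂̄φ` with `ψ` remain, both of degree `k + 1 = n`; the non-invariant
    -- products in degrees `n - 1` and `n + 1` have dropped out.
    simp only [l2Inner_eq_of_conformal hΦ h hk]

/-- In the middle degree, conformal Hermitian metrics have the same harmonic forms. -/
lemma harmonicForms_eq_of_conformal (hΦ : ∀ x, 0 < Φ x)
    (h : ∀ (x : M) (u v : TangentSpace (𝓡 (2 * n)) x),
      g'.fundamentalForm x u v = Φ x * g.fundamentalForm x u v) {p q : ℕ} (hpq : p + q = n) :
    g'.harmonicForms p q = g.harmonicForms p q :=
  Set.ext fun _ => and_congr_right fun hψ =>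
    isDbarLaplacian_zero_iff_of_conformal hΦ h hpq hψ.1

lemma hodgeNumber_eq_of_conformal (hΦ : ∀ x, 0 < Φ x)
    (h : ∀ (x : M) (u v : TangentSpace (𝓡 (2 * n)) x),
      g'.fundamentalForm x u v = Φ x * g.fundamentalForm x u v) {p q : ℕ} (hpq : p + q = n) :
    g'.hodgeNumber p q = g.hodgeNumber p q := by
  rw [hodgeNumber, hodgeNumber, harmonicForms_eq_of_conformal hΦ h hpq]

end HermitianMetric

end AlmostHermitian

open AlmostHermitian in
theorem mainTheorem5 {n : ℕ} {M : Type*} [TopologicalSpace M] [ChartedSpace (Model n) M]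
    [IsManifold (𝓡 (2 * n)) ∞ M] [T2Space M] [CompactSpace M]
    (J : AlmostComplexStructure n M) (g g' : HermitianMetric J)
    (Φ : M → ℝ) (hΦ : ContMDiff (𝓡 (2 * n)) 𝓘(ℝ, ℝ) ∞ Φ) (hΦpos : ∀ x, 0 < Φ x)
    (hconf : ∀ (x : M) (u v : TangentSpace (𝓡 (2 * n)) x),
      g'.fundamentalForm x u v = Φ x * g.fundamentalForm x u v) :
    (∀ p q : ℕ, p + q = n →
      g'.harmonicForms p q = g.harmonicForms p q ∧ g'.hodgeNumber p q = g.hodgeNumber p q) ∧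
    (n = 2 → g'.hodgeNumber 1 1 = g.hodgeNumber 1 1) :=
  ⟨fun _ _ hpq => ⟨HermitianMetric.harmonicForms_eq_of_conformal hΦpos hconf hpq,
    HermitianMetric.hodgeNumber_eq_of_conformal hΦpos hconf hpq⟩,
    fun hn => HermitianMetric.hodgeNumber_eq_of_conformal hΦpos hconf hn.symm⟩
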